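/- Let $\theta_1,\theta_2>0$, $\mathbb{R}^2_+=\{(x_1,x_2): x_1,x_2\ge 0\}$, and let $H:\mathbb{R}^2_+\to\mathbb{R}^2_+$ be the quadratic operator $$H(x_1,x_2)=\Big(\tfrac{\theta_1x_1}{2}(x_1+2x_2),\ \tfrac{\theta_2x_2}{2}(x_2+2x_1)\Big).$$ Put $E_1=(\tfrac{2}{\theta_1},0)$, $E_2=(0,\tfrac{2}{\theta_2})$ and $\overline E=\Big(\tfrac{4\theta_1-2\theta_2}{3\theta_1\theta_2},\tfrac{4\theta_2-2\theta_1}{3\theta_1\theta_2}\Big)$. For a continuous function $\gamma:[0,\tfrac{2}{\theta_1}]\to[0,\infty)$ identify $\gamma$ with the curve $\{(x_1,\gamma(x_1)): 0\le x_1\le \tfrac{2}{\theta_1}\}$; it is called invariant if $H$ maps it into itself. (a) If $\theta_1<2\theta_2$ and $\theta_2<2\theta_1$, then there is an invariant curve $\gamma$ passing through $E_1$, $E_2$ and $\overline E$ such that for every $x^0=(x_1^0,x_2^0)\in\mathbb{R}^2_+$ that is not a fixed point of $H$: - if $0\le x_1^0<\tfrac{2}{\theta_1}$ and $0\le x_2^0<\gamma(x_1^0)$,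 then $\lim_{m\to\infty}H^m(x^0)=(0,0)$; - if $0<x_1^0<\tfrac{2}{\theta_1}$ and $x_2^0=\gamma(x_1^0)$, then $\lim_{m\to\infty}H^m(x^0)=\overline E$; - if $x^0$ lies above the curve, i.e. either $0\le x_1^0\le\tfrac{2}{\theta_1}$ and $x_2^0>\gamma(x_1^0)$, or $x_1^0>\tfrac{2}{\theta_1}$, then $\lim_{m\to\infty}\|H^m(x^0)\|=\infty$. (b) If $\theta_1>2\theta_2$, then there is an invariant curve $\sigma$ passing through $E_1$ and $E_2$ such that the three assertions of (a) hold with $\sigma$ in place of $\gamma$ and $E_1$ in place of $\overline E$ as the limit in the second one. (c) If $\theta_2>2\theta_1$, then there is an invariant curve $\delta$ passing through $E_1$ and $E_2$ such that the three assertions of (a) hold with $\delta$ in place of $\gamma$ and $E_2$ in place of $\overline E$ as the limit in the second one. -/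

import Mathlib

open Filter Topology Set

/-- The quadratic operator
`x_k' = (θ_k x_k / 2) * (x_k + 2 ∑_{i ≠ k} x_i)`, `k = 1, …, n`. -/
noncomputable def quadOp {n : ℕ} (θ : Fin n → ℝ) (x : Fin n → ℝ) : Fin n → ℝ :=
  fun k => θ k * x k / 2 * (x k + 2 * ∑ i ∈ Finset.univ.erase k, x i)

/-- The fixed point `E₁ = (2/θ₁, 0)` of the planar operator. -/
noncomputable def ptE1 (θ₁ : ℝ) : Fin 2 → ℝ := ![2 / θ₁, 0]

/-- The fixed point `E₂ = (0, 2/θ₂)` of the planar operator. -/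
noncomputable def ptE2 (θ₂ : ℝ) : Fin 2 → ℝ := ![0, 2 / θ₂]

/-- The fixed point `Ē` of the planar operator with two nonzero coordinates. -/
noncomputable def ptEbar (θ₁ θ₂ : ℝ) : Fin 2 → ℝ :=
  ![(4 * θ₁ - 2 * θ₂) / (3 * θ₁ * θ₂), (4 * θ₂ - 2 * θ₁) / (3 * θ₁ * θ₂)]

/-- The curve `x₂ = γ(x₁)`, `0 ≤ x₁ ≤ a`, as a subset of the plane. -/
def curveOver (a : ℝ) (γ : ℝ → ℝ) : Set (Fin 2 → ℝ) :=
  {p | p 0 ∈ Icc 0 a ∧ p 1 = γ (p 0)}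

/-- `γ` (used only on `[0, 2/θ₁]`) is a continuous curve in the closed quadrant, invariant under
the planar operator, passing through `E₁` and `E₂`, and it separates the non-fixed initial points
of the closed quadrant: below it orbits tend to the origin, on it (away from the axes) they tend
to `L`, and above it they tend to infinity. The curve ends at `E₁` on the `x₁`-axis, so
every point with `x₁ > 2/θ₁` lies above it. -/
structure IsInvariantSeparatingCurve (θ₁ θ₂ : ℝ) (L : Fin 2 → ℝ) (γ : ℝ → ℝ) : Prop where
  continuousOn : ContinuousOn γ (Icc 0 (2 / θ₁))
  nonneg : ∀ x ∈ Icc 0 (2 / θ₁), 0 ≤ γ x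
  invariant : MapsTo (quadOp ![θ₁, θ₂]) (curveOver (2 / θ₁) γ) (curveOver (2 / θ₁) γ)
  ptE1_mem : ptE1 θ₁ ∈ curveOver (2 / θ₁) γ
  ptE2_mem : ptE2 θ₂ ∈ curveOver (2 / θ₁) γ
  below : ∀ p : Fin 2 → ℝ, (∀ i, 0 ≤ p i) → quadOp ![θ₁, θ₂] p ≠ p →
    p 0 < 2 / θ₁ → p 1 < γ (p 0) →
    Tendsto (fun m : ℕ => (quadOp ![θ₁, θ₂])^[m] p) atTop (𝓝 0)
  on_curve : ∀ p : Fin 2 → ℝ, (∀ i, 0 ≤ p i) → quadOp ![θ₁, θ₂] p ≠ p →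
    0 < p 0 → p 0 < 2 / θ₁ → p 1 = γ (p 0) →
    Tendsto (fun m : ℕ => (quadOp ![θ₁, θ₂])^[m] p) atTop (𝓝 L)
  above : ∀ p : Fin 2 → ℝ, (∀ i, 0 ≤ p i) → quadOp ![θ₁, θ₂] p ≠ p →
    (2 / θ₁ < p 0 ∨ (p 0 ≤ 2 / θ₁ ∧ γ (p 0) < p 1)) →
    Tendsto (fun m : ℕ => ‖(quadOp ![θ₁, θ₂])^[m] p‖) atTop atTop

/-! The operator H is monotone on the quadrant and homogeneous of degree 2, so the m-th iterate of t
• p is t ^ 2 ^ m times that of p. Hence if the orbit of p does not vanish, every point above t • p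
with t > 1 escapes (`orbitEscapes_of_smul_le`). The critical set, where orbits neither vanish nor
escape, is therefore thin: it meets each ray and each vertical line at most once. Vanishing and
escaping are open conditions in the quadrant, so connectedness of a vertical half-line yields a
critical point over each x in [0, 2/θ₁], and openness also makes the resulting graph continuous.
This graph is the separating curve. On the curve, homogeneity reduces the direction of the orbit to
a one-dimensional recursion for the coordinate ratio, which converges in each parameter range. The
critical set is compact and has one point per ray, so convergence of direction forces convergence of
the orbit. -/

section PlanarOperator

variable {θ : Fin 2 → ℝ} {p q L : Fin 2 → ℝ}

/-! ### Homogeneity, monotonicity and quadratic norm bounds. -/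

theorem quadOp_apply_zero (θ p : Fin 2 → ℝ) :
    quadOp θ p 0 = θ 0 * p 0 / 2 * (p 0 + 2 * p 1) := by
  have : (Finset.univ.erase 0 : Finset (Fin 2)) = {1} := by decide
  simp [quadOp, this]

theorem quadOp_apply_one (θ p : Fin 2 → ℝ) :
    quadOp θ p 1 = θ 1 * p 1 / 2 * (p 1 + 2 * p 0) := by
  have : (Finset.univ.erase 1 : Finset (Fin 2)) = {0} := by decide
  simp [quadOp, this]

theorem continuous_quadOp (θ : Fin 2 → ℝ) : Continuous (quadOp θ) := by
  unfold quadOp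
  fun_prop

theorem quadOp_smul (θ : Fin 2 → ℝ) (t : ℝ) (p : Fin 2 → ℝ) :
    quadOp θ (t • p) = t ^ 2 • quadOp θ p := by
  ext i
  fin_cases i
  · simp [quadOp_apply_zero]; ring
  · simp [quadOp_apply_one]; ring

theorem quadOp_mono (hθ : ∀ i, 0 < θ i) (hp : 0 ≤ p) (hpq : p ≤ q) :
    quadOp θ p ≤ quadOp θ q := by
  have h0 := hθ 0
  have h1 := hθ 1
  have p0 : 0 ≤ p 0 := hp 0
  have p1 : 0 ≤ p 1 := hp 1
  have q0 : p 0 ≤ q 0 := hpq 0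
  have q1 : p 1 ≤ q 1 := hpq 1
  have q0' := p0.trans q0
  have q1' := p1.trans q1
  intro i
  fin_cases i
  · simp only [Fin.zero_eta, quadOp_apply_zero]
    gcongr
  · simp only [Fin.mk_one, quadOp_apply_one]
    gcongr

theorem quadOp_nonneg (hθ : ∀ i, 0 < θ i) (hp : 0 ≤ p) : 0 ≤ quadOp θ p := by
  have h := quadOp_mono hθ le_rfl hp
  have h0 := quadOp_smul θ 0 0
  simp at h0
  rwa [h0] at h

theorem iterate_quadOp_nonneg (hθ : ∀ i, 0 < θ i) (hp : 0 ≤ p) (m : ℕ) :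
    0 ≤ (quadOp θ)^[m] p := by
  induction m with
  | zero => exact hp
  | succ m ih =>
    rw [Function.iterate_succ_apply']
    exact quadOp_nonneg hθ ih

theorem iterate_quadOp_mono (hθ : ∀ i, 0 < θ i) (hp : 0 ≤ p) (hpq : p ≤ q) (m : ℕ) :
    (quadOp θ)^[m] p ≤ (quadOp θ)^[m] q := by
  induction m with
  | zero => exact hpq
  | succ m ih =>
    rw [Function.iterate_succ_apply', Function.iterate_succ_apply']
    exact quadOp_mono hθ (iterate_quadOp_nonneg hθ hp m) ih

theorem iterate_quadOp_smul (θ : Fin 2 → ℝ) (t : ℝ) (p : Fin 2 → ℝ) (m : ℕ) :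
    (quadOp θ)^[m] (t • p) = t ^ 2 ^ m • (quadOp θ)^[m] p := by
  induction m with
  | zero => simp
  | succ m ih =>
    rw [Function.iterate_succ_apply', Function.iterate_succ_apply', ih, quadOp_smul, ← pow_mul,
      pow_succ]

theorem pi_norm_le_of_le (hp : 0 ≤ p) (hpq : p ≤ q) : ‖p‖ ≤ ‖q‖ := by
  refine (pi_norm_le_iff_of_nonneg (norm_nonneg _)).2 fun i => ?_
  have h1 : 0 ≤ p i := hp i
  have h2 : p i ≤ q i := hpq i
  calc ‖p i‖ = p i := by rw [Real.norm_of_nonneg h1]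
    _ ≤ q i := h2
    _ ≤ ‖q i‖ := Real.le_norm_self _
    _ ≤ ‖q‖ := norm_le_pi_norm q i

theorem exists_le_norm_quadOp (hθ : ∀ i, 0 < θ i) :
    ∃ c : ℝ, 0 < c ∧ ∀ p, 0 ≤ p → c * ‖p‖ ^ 2 ≤ ‖quadOp θ p‖ := by
  have h0 := hθ 0
  have h1 := hθ 1
  -- The constant comes from dropping the nonnegative cross terms.
  refine ⟨min (θ 0) (θ 1) / 2, by positivity, fun p hp => ?_⟩
  have p0 : 0 ≤ p 0 := hp 0
  have p1 : 0 ≤ p 1 := hp 1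
  have key : ∀ i, min (θ 0) (θ 1) / 2 * p i ^ 2 ≤ quadOp θ p i := by
    intro i
    fin_cases i
    · simp only [Fin.zero_eta, quadOp_apply_zero]
      have : min (θ 0) (θ 1) * p 0 ^ 2 ≤ θ 0 * p 0 ^ 2 := by gcongr; exact min_le_left _ _
      have : 0 ≤ θ 0 * p 0 * p 1 := by positivity
      nlinarith
    · simp only [Fin.mk_one, quadOp_apply_one]
      have : min (θ 0) (θ 1) * p 1 ^ 2 ≤ θ 1 * p 1 ^ 2 := by gcongr; exact min_le_right _ _
      have : 0 ≤ θ 1 * p 1 * p 0 := by positivity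
      nlinarith
  obtain ⟨i, hi⟩ : ∃ i, ‖p‖ = ‖p i‖ := by
    obtain ⟨i, hi⟩ := Finite.exists_max fun i => ‖p i‖
    exact ⟨i, le_antisymm ((pi_norm_le_iff_of_nonneg (norm_nonneg _)).2 hi) (norm_le_pi_norm p i)⟩
  rw [hi, Real.norm_eq_abs, sq_abs]
  exact (key i).trans ((Real.le_norm_self _).trans (norm_le_pi_norm _ i))

theorem exists_norm_quadOp_le (hθ : ∀ i, 0 < θ i) :
    ∃ C : ℝ, 0 < C ∧ ∀ p, 0 ≤ p → ‖quadOp θ p‖ ≤ C * ‖p‖ ^ 2 := by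
  have h0 := hθ 0
  have h1 := hθ 1
  refine ⟨‖quadOp θ 1‖ + 1, by positivity, fun p hp => ?_⟩
  have h : p ≤ ‖p‖ • 1 := fun i => by
    simpa using (Real.le_norm_self _).trans (norm_le_pi_norm p i)
  have := pi_norm_le_of_le (quadOp_nonneg hθ hp) (quadOp_mono hθ hp h)
  rw [quadOp_smul, norm_smul, norm_pow, norm_norm] at this
  nlinarith [sq_nonneg ‖p‖]

/-! ### Vanishing, escaping and critical orbits. -/

/-- The orbit of `p` under the planar operator tends to the origin. -/
def OrbitVanishes (θ p : Fin 2 → ℝ) : Prop :=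
  Tendsto (fun m : ℕ => (quadOp θ)^[m] p) atTop (𝓝 0)

/-- The orbit of `p` under the planar operator tends to infinity. -/
def OrbitEscapes (θ p : Fin 2 → ℝ) : Prop :=
  Tendsto (fun m : ℕ => ‖(quadOp θ)^[m] p‖) atTop atTop

/-- A point of the closed quadrant whose orbit tends neither to the origin nor to infinity. -/
structure IsCritical (θ p : Fin 2 → ℝ) : Prop where
  nonneg : 0 ≤ p
  not_vanishes : ¬ OrbitVanishes θ p
  not_escapes : ¬ OrbitEscapes θ p

theorem OrbitEscapes.not_vanishes (h : OrbitEscapes θ p) : ¬ OrbitVanishes θ p := fun h' =>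
  not_tendsto_nhds_of_tendsto_atTop h _ h'.norm

theorem orbitVanishes_iterate_iff (m : ℕ) :
    OrbitVanishes θ ((quadOp θ)^[m] p) ↔ OrbitVanishes θ p := by
  unfold OrbitVanishes
  simp only [← Function.iterate_add_apply]
  exact tendsto_add_atTop_iff_nat (f := fun k => (quadOp θ)^[k] p) m

theorem orbitEscapes_iterate_iff (m : ℕ) :
    OrbitEscapes θ ((quadOp θ)^[m] p) ↔ OrbitEscapes θ p := by
  unfold OrbitEscapes
  simp only [← Function.iterate_add_apply]
  exact tendsto_add_atTop_iff_nat (f := fun k => ‖(quadOp θ)^[k] p‖) m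

theorem IsCritical.iterate (hθ : ∀ i, 0 < θ i) (h : IsCritical θ p) (m : ℕ) :
    IsCritical θ ((quadOp θ)^[m] p) :=
  ⟨iterate_quadOp_nonneg hθ h.nonneg m, (orbitVanishes_iterate_iff m).not.2 h.not_vanishes,
    (orbitEscapes_iterate_iff m).not.2 h.not_escapes⟩

theorem tendsto_pow_two_pow_atTop {t : ℝ} (ht : 1 < t) :
    Tendsto (fun m : ℕ => t ^ 2 ^ m) atTop atTop :=
  (tendsto_pow_atTop_atTop_of_one_lt ht).comp (tendsto_pow_atTop_atTop_of_one_lt one_lt_two)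

theorem tendsto_pow_two_pow_zero {t : ℝ} (h0 : 0 ≤ t) (ht : t < 1) :
    Tendsto (fun m : ℕ => t ^ 2 ^ m) atTop (𝓝 0) :=
  (tendsto_pow_atTop_nhds_zero_of_lt_one h0 ht).comp
    (tendsto_pow_atTop_atTop_of_one_lt one_lt_two)

/-- Since c‖H p‖ ≥ (c‖p‖)², an orbit that once has c‖p‖ > 1 grows at least by repeated squaring. A
finite-time criterion makes escaping an open condition. -/
theorem exists_orbitEscapes_iff (hθ : ∀ i, 0 < θ i) :
    ∃ R : ℝ, 0 < R ∧ ∀ p, 0 ≤ p → (OrbitEscapes θ p ↔ ∃ m, R < ‖(quadOp θ)^[m] p‖) := by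
  obtain ⟨c, hc, hcp⟩ := exists_le_norm_quadOp hθ
  refine ⟨1 / c, by positivity, fun p hp => ⟨fun h => (h.eventually_gt_atTop _).exists, ?_⟩⟩
  rintro ⟨m, hm⟩
  rw [← orbitEscapes_iterate_iff m]
  set q := (quadOp θ)^[m] p
  have hq : 0 ≤ q := iterate_quadOp_nonneg hθ hp m
  have key : ∀ k, (c * ‖q‖) ^ 2 ^ k ≤ c * ‖(quadOp θ)^[k] q‖ := by
    intro k
    induction k with
    | zero => simp
    | succ k ih =>
      rw [Function.iterate_succ_apply', pow_succ, pow_mul]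
      calc ((c * ‖q‖) ^ 2 ^ k) ^ 2 ≤ (c * ‖(quadOp θ)^[k] q‖) ^ 2 := by gcongr
        _ = c * (c * ‖(quadOp θ)^[k] q‖ ^ 2) := by ring
        _ ≤ _ := by gcongr; exact hcp _ (iterate_quadOp_nonneg hθ hq k)
  have h1 : 1 < c * ‖q‖ := by rwa [div_lt_iff₀' hc] at hm
  exact (tendsto_const_mul_atTop_of_pos hc).1
    (tendsto_atTop_mono key (tendsto_pow_two_pow_atTop h1))

theorem exists_orbitVanishes_iff (hθ : ∀ i, 0 < θ i) :
    ∃ r : ℝ, 0 < r ∧ ∀ p, 0 ≤ p → (OrbitVanishes θ p ↔ ∃ m, ‖(quadOp θ)^[m] p‖ < r) := by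
  obtain ⟨C, hC, hCp⟩ := exists_norm_quadOp_le hθ
  refine ⟨1 / C, by positivity, fun p hp => ⟨fun h => ?_, ?_⟩⟩
  · have := h.norm
    rw [norm_zero] at this
    exact (this.eventually (gt_mem_nhds (by positivity : (0 : ℝ) < 1 / C))).exists
  rintro ⟨m, hm⟩
  rw [← orbitVanishes_iterate_iff m]
  set q := (quadOp θ)^[m] p
  have hq : 0 ≤ q := iterate_quadOp_nonneg hθ hp m
  have key : ∀ k, C * ‖(quadOp θ)^[k] q‖ ≤ (C * ‖q‖) ^ 2 ^ k := by
    intro k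
    induction k with
    | zero => simp
    | succ k ih =>
      rw [Function.iterate_succ_apply', pow_succ, pow_mul]
      calc _ ≤ C * (C * ‖(quadOp θ)^[k] q‖ ^ 2) := by
            gcongr; exact hCp _ (iterate_quadOp_nonneg hθ hq k)
        _ = (C * ‖(quadOp θ)^[k] q‖) ^ 2 := by ring
        _ ≤ _ := by gcongr
  have h1 : C * ‖q‖ < 1 := by rwa [lt_div_iff₀' hC] at hm
  have h2 := squeeze_zero (fun k => by positivity) key
    (tendsto_pow_two_pow_zero (by positivity) h1)
  have h3 := h2.const_mul C⁻¹
  simp only [inv_mul_cancel_left₀ hC.ne', mul_zero] at h3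
  exact tendsto_zero_iff_norm_tendsto_zero.2 h3

theorem exists_isOpen_orbitEscapes (hθ : ∀ i, 0 < θ i) :
    ∃ U : Set (Fin 2 → ℝ), IsOpen U ∧ ∀ p, 0 ≤ p → (p ∈ U ↔ OrbitEscapes θ p) := by
  obtain ⟨R, -, hR⟩ := exists_orbitEscapes_iff hθ
  refine ⟨{p | ∃ m, R < ‖(quadOp θ)^[m] p‖}, ?_, fun p hp => (hR p hp).symm⟩
  rw [ofPred_exists]
  exact isOpen_iUnion fun m =>
    isOpen_lt continuous_const ((continuous_quadOp θ).iterate m).norm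

theorem exists_isOpen_orbitVanishes (hθ : ∀ i, 0 < θ i) :
    ∃ U : Set (Fin 2 → ℝ), IsOpen U ∧ ∀ p, 0 ≤ p → (p ∈ U ↔ OrbitVanishes θ p) := by
  obtain ⟨r, -, hr⟩ := exists_orbitVanishes_iff hθ
  refine ⟨{p | ∃ m, ‖(quadOp θ)^[m] p‖ < r}, ?_, fun p hp => (hr p hp).symm⟩
  rw [ofPred_exists]
  exact isOpen_iUnion fun m =>
    isOpen_lt ((continuous_quadOp θ).iterate m).norm continuous_const

theorem isCompact_isCritical (hθ : ∀ i, 0 < θ i) :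
    IsCompact {p | IsCritical θ p} := by
  obtain ⟨U, hU, hU'⟩ := exists_isOpen_orbitEscapes hθ
  obtain ⟨V, hV, hV'⟩ := exists_isOpen_orbitVanishes hθ
  obtain ⟨R, hR0, hR⟩ := exists_orbitEscapes_iff hθ
  have : {p | IsCritical θ p} = Metric.closedBall 0 R ∩ (Ici 0 ∩ (Uᶜ ∩ Vᶜ)) := by
    ext p
    constructor
    · rintro ⟨h1, h2, h3⟩
      refine ⟨?_, h1, fun h => h3 ((hU' p h1).1 h), fun h => h2 ((hV' p h1).1 h)⟩
      rw [hR p h1] at h3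
      push Not at h3
      simpa using h3 0
    · rintro ⟨-, h1, h2, h3⟩
      exact ⟨h1, fun h => h3 ((hV' p h1).2 h), fun h => h2 ((hU' p h1).2 h)⟩
  rw [this]
  exact (isCompact_closedBall _ _).inter_right
    (isClosed_Ici.inter (hU.isClosed_compl.inter hV.isClosed_compl))

theorem orbitVanishes_zero (hθ : ∀ i, 0 < θ i) : OrbitVanishes θ 0 := by
  obtain ⟨r, hr0, hr⟩ := exists_orbitVanishes_iff hθ
  exact (hr 0 le_rfl).2 ⟨0, by simpa using hr0⟩

theorem isCritical_of_fixed (hp : 0 ≤ p) (hp0 : p ≠ 0) (h : quadOp θ p = p) :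
    IsCritical θ p := by
  have h' : ∀ m, (quadOp θ)^[m] p = p := fun m => Function.iterate_fixed h m
  refine ⟨hp, fun hv => ?_, fun he => ?_⟩
  · simp only [OrbitVanishes, h'] at hv
    exact hp0 (tendsto_nhds_unique tendsto_const_nhds hv)
  · simp only [OrbitEscapes, h'] at he
    exact not_tendsto_const_atTop _ _ he

/-! ### Comparison of orbits along rays and vertical lines. -/

/-- A non-vanishing orbit keeps norm at least r, and scaling by t multiplies its m-th term by t ^ 2
^ m. -/
theorem orbitEscapes_of_smul_le (hθ : ∀ i, 0 < θ i) (hp : 0 ≤ p) (hv : ¬ OrbitVanishes θ p)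
    {t : ℝ} (ht : 1 < t) (h : t • p ≤ q) : OrbitEscapes θ q := by
  obtain ⟨r, hr0, hr⟩ := exists_orbitVanishes_iff hθ
  rw [hr p hp] at hv
  push Not at hv
  have htp : 0 ≤ t • p := smul_nonneg (by linarith) hp
  refine tendsto_atTop_mono (fun m => ?_)
    ((tendsto_pow_two_pow_atTop ht).atTop_mul_const hr0)
  calc t ^ 2 ^ m * r ≤ t ^ 2 ^ m * ‖(quadOp θ)^[m] p‖ := by gcongr; exact hv m
    _ = ‖(quadOp θ)^[m] (t • p)‖ := by
      rw [iterate_quadOp_smul, norm_smul, Real.norm_of_nonneg (by positivity)]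
    _ ≤ _ := pi_norm_le_of_le (iterate_quadOp_nonneg hθ htp m) (iterate_quadOp_mono hθ htp h m)

theorem exists_one_lt_smul_le (h : ∀ i, p i < q i) : ∃ t : ℝ, 1 < t ∧ t • p ≤ q := by
  have h1 : ∀ i, ∀ᶠ t : ℝ in 𝓝[>] 1, t * p i < q i := fun i => by
    have : Tendsto (fun t : ℝ => t * p i) (𝓝[>] 1) (𝓝 (1 * p i)) :=
      (tendsto_id.mono_left nhdsWithin_le_nhds).mul_const _
    exact this.eventually (gt_mem_nhds (by simpa using h i))
  obtain ⟨t, ht, ht1⟩ := ((eventually_all.2 h1).and self_mem_nhdsWithin).exists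
  exact ⟨t, ht1, fun i => (ht i).le⟩

theorem orbitEscapes_of_vertical_lt (hθ : ∀ i, 0 < θ i) (hp : 0 ≤ p) (hv : ¬ OrbitVanishes θ p)
    (h0 : p 0 = q 0) (h1 : p 1 < q 1) : OrbitEscapes θ q := by
  have t0 := hθ 0
  have t1 := hθ 1
  have p0 : 0 ≤ p 0 := hp 0
  have p1 : 0 ≤ p 1 := hp 1
  rcases p0.eq_or_lt with hz | hpos
  · have p1' : 0 < p 1 := by
      refine p1.lt_of_ne fun h => hv ?_
      have : p = 0 := by ext i; fin_cases i <;> simp [← hz, ← h]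
      rw [this]
      exact orbitVanishes_zero hθ
    refine orbitEscapes_of_smul_le hθ hp hv ((one_lt_div p1').2 h1) fun i => ?_
    fin_cases i
    · simp [← hz, ← h0]
    · simp [p1'.ne']
  -- The first coordinates agree, but for p 0 > 0 the cross term makes the inequality strict in both
  -- coordinates after one step.
  · obtain ⟨t, ht, ht'⟩ : ∃ t : ℝ, 1 < t ∧ t • quadOp θ p ≤ quadOp θ q := by
      refine exists_one_lt_smul_le fun i => ?_
      fin_cases i
      · simp only [Fin.zero_eta, quadOp_apply_zero, ← h0]
        gcongr
      · simp only [Fin.mk_one, quadOp_apply_one, ← h0]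
        have : 0 < p 1 + 2 * p 0 := by positivity
        gcongr
    rw [← orbitEscapes_iterate_iff 1]
    exact orbitEscapes_of_smul_le hθ (quadOp_nonneg hθ hp)
      ((orbitVanishes_iterate_iff 1).not.2 hv) ht ht'

theorem IsCritical.vertical_unique (hθ : ∀ i, 0 < θ i) (hp : IsCritical θ p)
    (hq : IsCritical θ q) (h0 : p 0 = q 0) : p 1 = q 1 := by
  rcases lt_trichotomy (p 1) (q 1) with h | h | h
  · exact (hq.not_escapes (orbitEscapes_of_vertical_lt hθ hp.nonneg hp.not_vanishes h0 h)).elim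
  · exact h
  · exact
      (hp.not_escapes (orbitEscapes_of_vertical_lt hθ hq.nonneg hq.not_vanishes h0.symm h)).elim

/-! ### Fixed points and comparison with them. -/

theorem isCritical_ptE1 {θ₁ θ₂ : ℝ} (hθ₁ : 0 < θ₁) : IsCritical ![θ₁, θ₂] (ptE1 θ₁) := by
  refine isCritical_of_fixed (fun i => ?_) (fun h => ?_) ?_
  · fin_cases i <;> simp [ptE1]; positivity
  · have := congrFun h 0
    simp [ptE1, hθ₁.ne'] at this
  · ext i
    fin_cases i
    · simp [quadOp_apply_zero, ptE1]; field_simp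
    · simp [quadOp_apply_one, ptE1]

theorem isCritical_ptE2 {θ₁ θ₂ : ℝ} (hθ₂ : 0 < θ₂) : IsCritical ![θ₁, θ₂] (ptE2 θ₂) := by
  refine isCritical_of_fixed (fun i => ?_) (fun h => ?_) ?_
  · fin_cases i <;> simp [ptE2]; positivity
  · have := congrFun h 1
    simp [ptE2, hθ₂.ne'] at this
  · ext i
    fin_cases i
    · simp [quadOp_apply_zero, ptE2]
    · simp [quadOp_apply_one, ptE2]; field_simp

theorem isCritical_ptEbar {θ₁ θ₂ : ℝ} (hθ₁ : 0 < θ₁) (hθ₂ : 0 < θ₂) (h₁ : θ₁ < 2 * θ₂)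
    (h₂ : θ₂ < 2 * θ₁) : IsCritical ![θ₁, θ₂] (ptEbar θ₁ θ₂) := by
  have e0 : 0 < 4 * θ₁ - 2 * θ₂ := by linarith
  have e1 : 0 < 4 * θ₂ - 2 * θ₁ := by linarith
  have e0' : 0 < (4 * θ₁ - 2 * θ₂) / (3 * θ₁ * θ₂) := by positivity
  have e1' : 0 < (4 * θ₂ - 2 * θ₁) / (3 * θ₁ * θ₂) := by positivity
  refine isCritical_of_fixed (fun i => ?_) (fun h => ?_) ?_
  · fin_cases i
    · exact e0'.le
    · exact e1'.le
  · exact e0'.ne' (congrFun h 0)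
  · ext i
    fin_cases i
    · simp [quadOp_apply_zero, ptEbar]; field_simp; ring
    · simp [quadOp_apply_one, ptEbar]; field_simp; ring

theorem orbitEscapes_of_ptE1_lt {θ₁ θ₂ : ℝ} (hθ₁ : 0 < θ₁) (hθ₂ : 0 < θ₂) (hp : 0 ≤ p)
    (h : 2 / θ₁ < p 0) : OrbitEscapes ![θ₁, θ₂] p := by
  have hθ : ∀ i, 0 < ![θ₁, θ₂] i := by simp [Fin.forall_fin_two, hθ₁, hθ₂]
  have hE := isCritical_ptE1 (θ₂ := θ₂) hθ₁
  have h2 : 0 < 2 / θ₁ := by positivity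
  refine orbitEscapes_of_smul_le hθ hE.nonneg hE.not_vanishes ((one_lt_div h2).2 h) fun i => ?_
  fin_cases i
  · simp [ptE1]; field_simp; rfl
  · simpa [ptE1] using hp 1

theorem orbitEscapes_of_ptE2_lt {θ₁ θ₂ : ℝ} (hθ₁ : 0 < θ₁) (hθ₂ : 0 < θ₂) (hp : 0 ≤ p)
    (h : 2 / θ₂ < p 1) : OrbitEscapes ![θ₁, θ₂] p := by
  have hθ : ∀ i, 0 < ![θ₁, θ₂] i := by simp [Fin.forall_fin_two, hθ₁, hθ₂]
  have hE := isCritical_ptE2 (θ₁ := θ₁) hθ₂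
  have h2 : 0 < 2 / θ₂ := by positivity
  refine orbitEscapes_of_smul_le hθ hE.nonneg hE.not_vanishes ((one_lt_div h2).2 h) fun i => ?_
  fin_cases i
  · simpa [ptE2] using hp 0
  · simp [ptE2]; field_simp; rfl

theorem orbitVanishes_of_axis {θ₁ θ₂ : ℝ} (hθ₁ : 0 < θ₁) (hθ₂ : 0 < θ₂) (hp : 0 ≤ p)
    (h1 : p 1 = 0) (h : p 0 < 2 / θ₁) : OrbitVanishes ![θ₁, θ₂] p := by
  have hθ : ∀ i, 0 < ![θ₁, θ₂] i := by simp [Fin.forall_fin_two, hθ₁, hθ₂]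
  by_contra hv
  have hE := isCritical_ptE1 (θ₂ := θ₂) hθ₁
  obtain h0 | h0 : 0 = p 0 ∨ 0 < p 0 := (hp 0).eq_or_lt
  · refine hv ?_
    have : p = 0 := by ext i; fin_cases i <;> simp [← h0, h1]
    rw [this]
    exact orbitVanishes_zero hθ
  · refine hE.not_escapes (orbitEscapes_of_smul_le hθ hp hv ((one_lt_div h0).2 h) fun i => ?_)
    fin_cases i
    · simp [ptE1, h0.ne']
    · simp [ptE1, h1]

/-! ### The critical set as a continuous graph. -/

theorem exists_isCritical_vertical {θ₁ θ₂ : ℝ} (hθ₁ : 0 < θ₁) (hθ₂ : 0 < θ₂) {x : ℝ}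
    (hx : x ∈ Icc 0 (2 / θ₁)) : ∃ y, IsCritical ![θ₁, θ₂] ![x, y] := by
  have hθ : ∀ i, 0 < ![θ₁, θ₂] i := by simp [Fin.forall_fin_two, hθ₁, hθ₂]
  rcases hx.2.eq_or_lt with rfl | hlt
  · exact ⟨0, isCritical_ptE1 hθ₁⟩
  by_contra! hno
  obtain ⟨U, hU, hU'⟩ := exists_isOpen_orbitEscapes hθ
  obtain ⟨V, hV, hV'⟩ := exists_isOpen_orbitVanishes hθ
  have hpos : ∀ y, 0 ≤ y → 0 ≤ ![x, y] := fun y hy i => by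
    fin_cases i
    · exact hx.1
    · exact hy
  have hcont : Continuous fun y : ℝ => ![x, y] := by fun_prop
  -- Without a critical point, the half-line would be covered by two disjoint open sets: one
  -- contains its foot, the other its points above height 2/θ₂.
  obtain ⟨y, hy, hyV, hyU⟩ := isPreconnected_Ici (a := (0 : ℝ)) _ _ (hV.preimage hcont)
    (hU.preimage hcont)
    (fun y hy => by
      have := hno y
      rw [mem_union, mem_preimage, mem_preimage, hV' _ (hpos y hy), hU' _ (hpos y hy)]
      by_contra! h
      exact this ⟨hpos y hy, h.1, h.2⟩)
    ⟨0, self_mem_Ici, (hV' _ (hpos 0 le_rfl)).2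
      (orbitVanishes_of_axis hθ₁ hθ₂ (hpos 0 le_rfl) rfl hlt)⟩
    (by
      have h3 : 0 ≤ 2 / θ₂ + 1 := by positivity
      exact ⟨2 / θ₂ + 1, h3, (hU' _ (hpos _ h3)).2
        (orbitEscapes_of_ptE2_lt hθ₁ hθ₂ (hpos _ h3) (by simp))⟩)
  exact ((hU' _ (hpos y hy)).1 hyU).not_vanishes ((hV' _ (hpos y hy)).1 hyV)

theorem exists_isInvariantSeparatingCurve {θ₁ θ₂ : ℝ} (hθ₁ : 0 < θ₁) (hθ₂ : 0 < θ₂)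
    (hL : ∀ p, IsCritical ![θ₁, θ₂] p → 0 < p 0 → 0 < p 1 →
      Tendsto (fun m : ℕ => (quadOp ![θ₁, θ₂])^[m] p) atTop (𝓝 L)) :
    ∃ γ : ℝ → ℝ, IsInvariantSeparatingCurve θ₁ θ₂ L γ ∧
      ∀ p, IsCritical ![θ₁, θ₂] p → p ∈ curveOver (2 / θ₁) γ := by
  have hθ : ∀ i, 0 < ![θ₁, θ₂] i := by simp [Fin.forall_fin_two, hθ₁, hθ₂]
  choose! γ hγ using fun x (hx : x ∈ Icc 0 (2 / θ₁)) => exists_isCritical_vertical hθ₁ hθ₂ hx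
  have hmem : ∀ p, IsCritical ![θ₁, θ₂] p → p ∈ curveOver (2 / θ₁) γ := fun p hp => by
    have h0 : p 0 ∈ Icc 0 (2 / θ₁) := ⟨hp.nonneg 0, not_lt.1 fun h =>
      hp.not_escapes (orbitEscapes_of_ptE1_lt hθ₁ hθ₂ hp.nonneg h)⟩
    exact ⟨h0, hp.vertical_unique hθ (hγ _ h0) rfl⟩
  have hcrit : ∀ p ∈ curveOver (2 / θ₁) γ, IsCritical ![θ₁, θ₂] p := by
    rintro p ⟨h0, h1⟩
    convert hγ _ h0 using 1
    ext i
    fin_cases i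
    · rfl
    · exact h1
  have hnn : ∀ x ∈ Icc 0 (2 / θ₁), 0 ≤ γ x := fun x hx => (hγ x hx).nonneg 1
  have hbelow : ∀ p, 0 ≤ p → p 0 ∈ Icc 0 (2 / θ₁) → p 1 < γ (p 0) →
      OrbitVanishes ![θ₁, θ₂] p := fun p hp h0 h1 => by
    by_contra hv
    exact (hγ _ h0).not_escapes (orbitEscapes_of_vertical_lt hθ hp hv rfl h1)
  have habove : ∀ p, p 0 ∈ Icc 0 (2 / θ₁) → γ (p 0) < p 1 →
      OrbitEscapes ![θ₁, θ₂] p := fun p h0 h1 =>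
    orbitEscapes_of_vertical_lt hθ (hγ _ h0).nonneg (hγ _ h0).not_vanishes rfl h1
  refine ⟨γ, ⟨?_, hnn, ?_, hmem _ (isCritical_ptE1 hθ₁), hmem _ (isCritical_ptE2 hθ₂), ?_, ?_,
    ?_⟩, hmem⟩
  · obtain ⟨U, hU, hU'⟩ := exists_isOpen_orbitEscapes hθ
    obtain ⟨V, hV, hV'⟩ := exists_isOpen_orbitVanishes hθ
    have hpos : ∀ x ∈ Icc 0 (2 / θ₁), ∀ y, 0 ≤ y → 0 ≤ ![x, y] := fun x hx y hy i => by
      fin_cases i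
      · exact hx.1
      · exact hy
    have hcont : ∀ y : ℝ, Continuous fun x : ℝ => ![x, y] := fun y => by fun_prop
    intro x hx
    -- A point strictly below or above the graph vanishes or escapes, and by openness so do its
    -- horizontal neighbours, which keeps nearby values of γ on the same side. Negative a is
    -- separate because the open sets only describe orbits inside the quadrant.
    refine tendsto_order.2 ⟨fun a ha => ?_, fun b hb => ?_⟩
    · rcases lt_or_ge a 0 with ha0 | ha0
      · filter_upwards [self_mem_nhdsWithin] with z hz using ha0.trans_le (hnn z hz)
      · have h1 : x ∈ (fun x : ℝ => ![x, a]) ⁻¹' V :=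
          (hV' _ (hpos x hx a ha0)).2 (hbelow _ (hpos x hx a ha0) hx ha)
        filter_upwards [self_mem_nhdsWithin,
          mem_nhdsWithin_of_mem_nhds ((hV.preimage (hcont a)).mem_nhds h1)] with z hz hzV
        have hzv := (hV' _ (hpos z hz a ha0)).1 hzV
        rcases lt_trichotomy a (γ z) with h | h | h
        · exact h
        · exact ((hγ z hz).not_vanishes (h ▸ hzv)).elim
        · exact ((habove ![z, a] hz h).not_vanishes hzv).elim
    · have hb0 : 0 ≤ b := (hnn x hx).trans hb.le
      have h1 : x ∈ (fun x : ℝ => ![x, b]) ⁻¹' U :=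
        (hU' _ (hpos x hx b hb0)).2 (habove ![x, b] hx hb)
      filter_upwards [self_mem_nhdsWithin,
        mem_nhdsWithin_of_mem_nhds ((hU.preimage (hcont b)).mem_nhds h1)] with z hz hzU
      have hzu := (hU' _ (hpos z hz b hb0)).1 hzU
      rcases lt_trichotomy b (γ z) with h | h | h
      · exact (hzu.not_vanishes (hbelow ![z, b] (hpos z hz b hb0) hz h)).elim
      · exact ((hγ z hz).not_escapes (h ▸ hzu)).elim
      · exact h
  · exact fun p hp => hmem _ ((hcrit p hp).iterate hθ 1)
  · exact fun p hp _ h0 h1 => hbelow p hp ⟨hp 0, h0.le⟩ h1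
  · intro p hp _ h0 h0' h1
    have hc := hcrit p ⟨⟨h0.le, h0'.le⟩, h1⟩
    refine hL p hc h0 ((hp 1).lt_of_ne fun h => ?_)
    exact hc.not_vanishes (orbitVanishes_of_axis hθ₁ hθ₂ hp h.symm h0')
  · rintro p hp - (h | ⟨h0, h1⟩)
    · exact orbitEscapes_of_ptE1_lt hθ₁ hθ₂ hp h
    · exact habove p ⟨hp 0, h0⟩ h1

/-! ### Convergence on the curve. -/

/-- The orbit stays in the compact critical set, and each cluster point lies on the ray of L, where
L is the only critical point. -/
theorem IsCritical.tendsto_of_direction (hθ : ∀ i, 0 < θ i) (hp : IsCritical θ p)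
    (hL : IsCritical θ L)
    (h : Tendsto (fun m : ℕ => L 0 * (quadOp θ)^[m] p 1 - L 1 * (quadOp θ)^[m] p 0)
      atTop (𝓝 0)) :
    Tendsto (fun m : ℕ => (quadOp θ)^[m] p) atTop (𝓝 L) := by
  refine (isCompact_isCritical hθ).tendsto_nhds_of_unique_mapClusterPt
    (Eventually.of_forall fun m => hp.iterate hθ m) fun y hy hyc => ?_
  have hy0 : L 0 * y 1 - L 1 * y 0 = 0 := by
    have hc : Continuous fun z : Fin 2 → ℝ => L 0 * z 1 - L 1 * z 0 := by fun_prop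
    have h1 : MapClusterPt (L 0 * y 1 - L 1 * y 0) atTop
        fun m : ℕ => L 0 * (quadOp θ)^[m] p 1 - L 1 * (quadOp θ)^[m] p 0 :=
      hyc.continuousAt_comp (hc.continuousAt (x := y))
    exact eq_of_nhds_neBot (ClusterPt.mono h1 h)
  obtain ⟨t, ht, rfl⟩ : ∃ t : ℝ, 0 ≤ t ∧ y = t • L := by
    obtain hl | hl : 0 = L 0 ∨ 0 < L 0 := (hL.nonneg 0).eq_or_lt
    · obtain hl1 | hl1 : 0 = L 1 ∨ 0 < L 1 := (hL.nonneg 1).eq_or_lt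
      · refine (hL.not_vanishes ?_).elim
        have : L = 0 := by ext i; fin_cases i <;> simp [← hl, ← hl1]
        rw [this]
        exact orbitVanishes_zero hθ
      · refine ⟨y 1 / L 1, div_nonneg (hy.nonneg 1) hl1.le, ?_⟩
        have : y 0 = 0 := by simpa [← hl, hl1.ne'] using hy0
        ext i
        fin_cases i
        · simp [this, ← hl]
        · simp [hl1.ne']
    · refine ⟨y 0 / L 0, div_nonneg (hy.nonneg 0) hl.le, ?_⟩
      ext i
      fin_cases i
      · simp [hl.ne']
      · simp
        field_simp
        linarith
  rcases lt_trichotomy t 1 with h1 | rfl | h1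
  · rcases ht.eq_or_lt with rfl | h0
    · rw [zero_smul] at hy
      exact (hy.not_vanishes (orbitVanishes_zero hθ)).elim
    · refine (hL.not_escapes (orbitEscapes_of_smul_le hθ hy.nonneg hy.not_vanishes
        ((one_lt_inv₀ h0).2 h1) ?_)).elim
      rw [inv_smul_smul₀ h0.ne']
  · exact one_smul _ _
  · exact (hy.not_escapes (orbitEscapes_of_smul_le hθ hL.nonneg hL.not_vanishes h1 le_rfl)).elim

/-- The ratio of the coordinates of an orbit obeys this recursion; with `k < 1 / 2` it tends
to `0`. -/
theorem tendsto_ratio_zero {k : ℝ} (hk0 : 0 < k) (hk : k < 1 / 2) {r : ℕ → ℝ}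
    (hr : ∀ m, 0 < r m) (hrec : ∀ m, r (m + 1) = k * r m * (r m + 2) / (1 + 2 * r m)) :
    Tendsto r atTop (𝓝 0) := by
  have key : ∀ m, r m ≤ (2 * k) ^ m * r 0 := by
    intro m
    induction m with
    | zero => simp
    | succ m ih =>
      have h := hr m
      calc r (m + 1) ≤ 2 * k * r m := by
            rw [hrec, div_le_iff₀ (by positivity)]
            have : 0 < k * r m * r m := by positivity
            nlinarith
        _ ≤ 2 * k * ((2 * k) ^ m * r 0) := by gcongr
        _ = _ := by ring
  refine squeeze_zero (fun m => (hr m).le) key ?_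
  simpa using (tendsto_pow_atTop_nhds_zero_of_lt_one (by positivity)
    (by linarith : 2 * k < 1)).mul_const (r 0)

/-- The hypothesis on k says that s is the positive fixed point of the recursion. Each step
multiplies r - s by a factor in (0, 1), so r never crosses s and stays above min s (r 0). The factor
decreases in r, so this lower bound gives a uniform contraction constant. -/
theorem tendsto_ratio_fixed {k s : ℝ} (hs : 0 < s) (hk : k * (s + 2) = 1 + 2 * s) {r : ℕ → ℝ}
    (hr : ∀ m, 0 < r m) (hrec : ∀ m, r (m + 1) = k * r m * (r m + 2) / (1 + 2 * r m)) :
    Tendsto r atTop (𝓝 s) := by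
  obtain rfl : k = (1 + 2 * s) / (s + 2) := by field_simp; linarith
  have hdiff : ∀ m, r (m + 1) - s =
      (1 - 3 * r m / ((s + 2) * (1 + 2 * r m))) * (r m - s) := fun m => by
    have h := hr m
    rw [hrec]
    field_simp
    ring
  have hfac : ∀ m, 0 < 1 - 3 * r m / ((s + 2) * (1 + 2 * r m)) := fun m => by
    have h := hr m
    rw [sub_pos, div_lt_one (by positivity)]
    have : 0 < s * r m := by positivity
    nlinarith
  obtain ⟨ρ, hρ, hρs, hρ0⟩ : ∃ ρ, 0 < ρ ∧ ρ ≤ s ∧ ρ ≤ r 0 :=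
    ⟨min s (r 0), lt_min hs (hr 0), min_le_left _ _, min_le_right _ _⟩
  have hlow : ∀ m, ρ ≤ r m := by
    intro m
    induction m with
    | zero => exact hρ0
    | succ m ih =>
      have h := hr m
      rcases le_total s (r m) with h1 | h1
      · have := mul_nonneg (hfac m).le (sub_nonneg.2 h1)
        linarith [hdiff m]
      · have h2 : 0 ≤ 3 * r m / ((s + 2) * (1 + 2 * r m)) := by positivity
        have := mul_nonneg h2 (sub_nonneg.2 h1)
        nlinarith [hdiff m]
  set c := 1 - 3 * ρ / ((s + 2) * (1 + 2 * ρ)) with hc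
  have hfc : ∀ m, 1 - 3 * r m / ((s + 2) * (1 + 2 * r m)) ≤ c := fun m => by
    have h := hr m
    have h' := hlow m
    rw [hc, sub_le_sub_iff_left, div_le_div_iff₀ (by positivity) (by positivity)]
    nlinarith
  have hc0 : 0 ≤ c := (hfac 0).le.trans (hfc 0)
  have hc1 : c < 1 := by
    have : 0 < 3 * ρ / ((s + 2) * (1 + 2 * ρ)) := by positivity
    linarith
  have key : ∀ m, |r m - s| ≤ c ^ m * |r 0 - s| := by
    intro m
    induction m with
    | zero => simp
    | succ m ih =>
      rw [hdiff, abs_mul, abs_of_pos (hfac m), pow_succ', mul_assoc]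
      exact mul_le_mul (hfc m) ih (abs_nonneg _) hc0
  refine tendsto_sub_nhds_zero_iff.1 (squeeze_zero_norm key ?_)
  simpa using (tendsto_pow_atTop_nhds_zero_of_lt_one hc0 hc1).mul_const |r 0 - s|

theorem iterate_quadOp_pos (hθ : ∀ i, 0 < θ i) (hp : ∀ i, 0 < p i) (m : ℕ) (i : Fin 2) :
    0 < (quadOp θ)^[m] p i := by
  induction m generalizing i with
  | zero => exact hp i
  | succ m ih =>
    rw [Function.iterate_succ_apply']
    have h0 := ih 0
    have h1 := ih 1
    have t0 := hθ 0
    have t1 := hθ 1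
    fin_cases i
    · simp only [Fin.zero_eta, quadOp_apply_zero]
      positivity
    · simp only [Fin.mk_one, quadOp_apply_one]
      positivity

theorem quadOp_ratio_one_zero (hθ : ∀ i, 0 < θ i) (hp : ∀ i, 0 < p i) :
    quadOp θ p 1 / quadOp θ p 0 =
      θ 1 / θ 0 * (p 1 / p 0) * (p 1 / p 0 + 2) / (1 + 2 * (p 1 / p 0)) := by
  have h0 := hp 0
  have h1 := hp 1
  have t0 := hθ 0
  rw [quadOp_apply_one, quadOp_apply_zero]
  field_simp

theorem quadOp_ratio_zero_one (hθ : ∀ i, 0 < θ i) (hp : ∀ i, 0 < p i) :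
    quadOp θ p 0 / quadOp θ p 1 =
      θ 0 / θ 1 * (p 0 / p 1) * (p 0 / p 1 + 2) / (1 + 2 * (p 0 / p 1)) := by
  have h0 := hp 0
  have h1 := hp 1
  have t0 := hθ 1
  rw [quadOp_apply_one, quadOp_apply_zero]
  field_simp

theorem IsCritical.tendsto_mul_zero (hθ : ∀ i, 0 < θ i) (hp : IsCritical θ p) (i : Fin 2)
    {u : ℕ → ℝ} (hu : Tendsto u atTop (𝓝 0)) :
    Tendsto (fun m : ℕ => (quadOp θ)^[m] p i * u m) atTop (𝓝 0) := by
  obtain ⟨R, hR⟩ := (isCompact_isCritical hθ).isBounded.exists_norm_le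
  refine squeeze_zero_norm (a := fun m => R * ‖u m‖) (fun m => ?_)
    (by simpa using hu.norm.const_mul R)
  rw [norm_mul]
  gcongr
  exact (norm_le_pi_norm _ i).trans (hR _ (hp.iterate hθ m))

theorem IsCritical.tendsto_of_ratio_one_zero (hθ : ∀ i, 0 < θ i) (hp : IsCritical θ p)
    (hpos : ∀ i, 0 < p i) (hL : IsCritical θ L) {s : ℝ} (hs : L 1 = L 0 * s)
    (h : Tendsto (fun m : ℕ => (quadOp θ)^[m] p 1 / (quadOp θ)^[m] p 0) atTop (𝓝 s)) :
    Tendsto (fun m : ℕ => (quadOp θ)^[m] p) atTop (𝓝 L) := by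
  refine hp.tendsto_of_direction hθ hL ?_
  have h1 := hp.tendsto_mul_zero hθ 0 ((tendsto_sub_nhds_zero_iff.2 h).const_mul (L 0)
    |>.trans (by simp))
  refine h1.congr fun m => ?_
  have := iterate_quadOp_pos hθ hpos m 0
  rw [hs]
  field_simp

theorem IsCritical.tendsto_of_ratio_zero_one (hθ : ∀ i, 0 < θ i) (hp : IsCritical θ p)
    (hpos : ∀ i, 0 < p i) (hL : IsCritical θ L) (hL0 : L 0 = 0)
    (h : Tendsto (fun m : ℕ => (quadOp θ)^[m] p 0 / (quadOp θ)^[m] p 1) atTop (𝓝 0)) :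
    Tendsto (fun m : ℕ => (quadOp θ)^[m] p) atTop (𝓝 L) := by
  refine hp.tendsto_of_direction hθ hL ?_
  have h1 := hp.tendsto_mul_zero hθ 1 (h.const_mul (-L 1) |>.trans (by simp))
  refine h1.congr fun m => ?_
  have := iterate_quadOp_pos hθ hpos m 1
  rw [hL0]
  field_simp
  ring

end PlanarOperator

theorem mainTheorem4 (θ₁ θ₂ : ℝ) (hθ₁ : 0 < θ₁) (hθ₂ : 0 < θ₂) :
    (θ₁ < 2 * θ₂ → θ₂ < 2 * θ₁ →
      ∃ γ : ℝ → ℝ, IsInvariantSeparatingCurve θ₁ θ₂ (ptEbar θ₁ θ₂) γ ∧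
        ptEbar θ₁ θ₂ ∈ curveOver (2 / θ₁) γ) ∧
    (2 * θ₂ < θ₁ →
      ∃ σ : ℝ → ℝ, IsInvariantSeparatingCurve θ₁ θ₂ (ptE1 θ₁) σ) ∧
    (2 * θ₁ < θ₂ →
      ∃ δ : ℝ → ℝ, IsInvariantSeparatingCurve θ₁ θ₂ (ptE2 θ₂) δ) := by
  have hθ : ∀ i, 0 < ![θ₁, θ₂] i := by simp [Fin.forall_fin_two, hθ₁, hθ₂]
  refine ⟨fun h₁ h₂ => ?_, fun h => ?_, fun h => ?_⟩
  · have hL := isCritical_ptEbar hθ₁ hθ₂ h₁ h₂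
    have e0 : 0 < 2 * θ₁ - θ₂ := by linarith
    have e1 : 0 < 2 * θ₂ - θ₁ := by linarith
    obtain ⟨γ, hγ, hmem⟩ := exists_isInvariantSeparatingCurve (L := ptEbar θ₁ θ₂) hθ₁ hθ₂
      fun p hp h0 h1 => by
        have hpos : ∀ i, 0 < p i := Fin.forall_fin_two.2 ⟨h0, h1⟩
        refine hp.tendsto_of_ratio_one_zero hθ hpos hL
          -- This is the coordinate ratio of `ptEbar`.
          (s := (2 * θ₂ - θ₁) / (2 * θ₁ - θ₂)) ?_
          (tendsto_ratio_fixed (k := θ₂ / θ₁) (by positivity) ?_ (fun m => ?_) fun m => ?_)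
        · simp only [ptEbar, Matrix.cons_val_zero, Matrix.cons_val_one]
          field_simp
          ring
        · have e0' := e0.ne'
          rw [div_add' _ _ _ e0', div_mul_div_comm, mul_div_assoc', one_add_div e0',
            div_eq_div_iff (by positivity) e0']
          ring
        · exact div_pos (iterate_quadOp_pos hθ hpos m 1) (iterate_quadOp_pos hθ hpos m 0)
        · rw [Function.iterate_succ_apply']
          exact quadOp_ratio_one_zero hθ (iterate_quadOp_pos hθ hpos m)
    exact ⟨γ, hγ, hmem _ hL⟩
  · obtain ⟨γ, hγ, -⟩ := exists_isInvariantSeparatingCurve (L := ptE1 θ₁) hθ₁ hθ₂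
      fun p hp h0 h1 => by
        have hpos : ∀ i, 0 < p i := Fin.forall_fin_two.2 ⟨h0, h1⟩
        refine hp.tendsto_of_ratio_one_zero hθ hpos (isCritical_ptE1 hθ₁) (s := 0)
          (by simp [ptE1])
          (tendsto_ratio_zero (k := θ₂ / θ₁) (by positivity) ?_ (fun m => ?_) fun m => ?_)
        · rw [div_lt_div_iff₀ hθ₁ two_pos]
          linarith
        · exact div_pos (iterate_quadOp_pos hθ hpos m 1) (iterate_quadOp_pos hθ hpos m 0)
        · rw [Function.iterate_succ_apply']
          exact quadOp_ratio_one_zero hθ (iterate_quadOp_pos hθ hpos m)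
    exact ⟨γ, hγ⟩
  · obtain ⟨γ, hγ, -⟩ := exists_isInvariantSeparatingCurve (L := ptE2 θ₂) hθ₁ hθ₂
      fun p hp h0 h1 => by
        have hpos : ∀ i, 0 < p i := Fin.forall_fin_two.2 ⟨h0, h1⟩
        -- The limit lies on the vertical axis, so the inverse ratio is the one that tends to 0.
        refine hp.tendsto_of_ratio_zero_one hθ hpos (isCritical_ptE2 hθ₂) (by simp [ptE2])
          (tendsto_ratio_zero (k := θ₁ / θ₂) (by positivity) ?_ (fun m => ?_) fun m => ?_)
        · rw [div_lt_div_iff₀ hθ₂ two_pos]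
          linarith
        · exact div_pos (iterate_quadOp_pos hθ hpos m 0) (iterate_quadOp_pos hθ hpos m 1)
        · rw [Function.iterate_succ_apply']
          exact quadOp_ratio_zero_one hθ (iterate_quadOp_pos hθ hpos m)
    exact ⟨γ, hγ⟩
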